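/- A Seidel matrix of order $n$ is a real symmetric $n\times n$ matrix $S$ with zero diagonal and all off-diagonal entries in $\{1,-1\}$. Its graph is the simple graph on $\{1,\dots,n\}$ in which distinct vertices $i,j$ are adjacent if and only if $S_{ij}=-1$. For $U\subseteq\{1,\dots,n\}$ let $D_U$ be the diagonal matrix with $(D_U)_{ii}=1$ for $i\in U$ and $(D_U)_{ii}=-1$ for $i\notin U$. The switching class of $S$ is the set of all graphs of the Seidel matrices $D_USD_U$, where $U\subseteq\{1,\dots,n\}$. **Theorem.** Let $S$ be a Seidel matrix of order $n\geq 277$ whose smallest eigenvalue is $-5$. If the switching class of $S$ contains a graph whose maximum valency (vertex degree) is at most $16$, then $$\operatorname{rk}(S+5I)\;\geq\;\frac{2n}{3}+1,$$ where $I$ is the $n\times n$ identity matrix. -/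

import Mathlib

/-- A Seidel matrix on the index set `V`: a real symmetric matrix with zero diagonal and all
off-diagonal entries equal to `1` or `-1`. -/
structure IsSeidel {V : Type*} (S : Matrix V V ℝ) : Prop where
  symm : S.IsSymm
  diag : ∀ i, S i i = 0
  offDiag : ∀ i j, i ≠ j → S i j = 1 ∨ S i j = -1

/-- The graph `G(S)` corresponding to a Seidel matrix `S`: two distinct vertices `i`, `j` are
adjacent if and only if `S i j = -1`. -/
def IsSeidel.graph {V : Type*} {S : Matrix V V ℝ} (hS : IsSeidel S) : SimpleGraph V where
  Adj i j := i ≠ j ∧ S i j = -1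
  symm := ⟨fun i j h => ⟨h.1.symm, by rw [hS.symm.apply]; exact h.2⟩⟩
  loopless := ⟨fun _ h => h.1 rfl⟩

open Classical in
/-- The Seidel matrix `S(G) = J - I - 2 A(G)` of a graph `G`. -/
noncomputable def seidelMatrix {V : Type*} (G : SimpleGraph V) : Matrix V V ℝ :=
  Matrix.of (fun _ _ => (1 : ℝ)) - 1 - (2 : ℝ) • G.adjMatrix ℝ

theorem isSeidel_seidelMatrix {V : Type*} (G : SimpleGraph V) : IsSeidel (seidelMatrix G) where
  symm := by
    classical
    have h1 : (Matrix.of (fun _ _ => (1 : ℝ)) : Matrix V V ℝ).IsSymm := rfl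
    exact (h1.sub Matrix.isSymm_one).sub ((G.isSymm_adjMatrix (α := ℝ)).smul 2)
  diag i := by simp [seidelMatrix]
  offDiag i j h := by
    by_cases hij : G.Adj i j
    · right
      simp [seidelMatrix, h, hij]
      norm_num
    · left
      simp [seidelMatrix, h, hij]

/-- The diagonal matrix `D_U`, with diagonal entry `1` at the elements of `U` and `-1` at all
other elements. -/
def switchDiag {V : Type*} [DecidableEq V] (U : Finset V) : Matrix V V ℝ :=
  Matrix.diagonal fun i => if i ∈ U then 1 else -1

/-- Switching a matrix with respect to `U`: the matrix `D_U S D_U`. -/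
def switchMatrix {V : Type*} [Fintype V] [DecidableEq V] (S : Matrix V V ℝ) (U : Finset V) :
    Matrix V V ℝ :=
  switchDiag U * S * switchDiag U

theorem IsSeidel.switchMatrix {V : Type*} [Fintype V] [DecidableEq V] {S : Matrix V V ℝ}
    (hS : IsSeidel S) (U : Finset V) : IsSeidel (switchMatrix S U) where
  symm := by
    ext i j
    simp only [_root_.switchMatrix, switchDiag, Matrix.transpose_apply, Matrix.mul_diagonal,
      Matrix.diagonal_mul, hS.symm.apply i j]
    ring
  diag i := by simp [_root_.switchMatrix, switchDiag, hS.diag]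
  offDiag i j h := by
    simp only [_root_.switchMatrix, switchDiag, Matrix.mul_diagonal, Matrix.diagonal_mul]
    rcases hS.offDiag i j h with h | h <;> rw [h] <;> split_ifs <;> norm_num

/-- The graph obtained from `G` by switching with respect to `U`. -/
noncomputable def switchGraph {V : Type*} [Fintype V] [DecidableEq V] (G : SimpleGraph V)
    (U : Finset V) : SimpleGraph V :=
  ((isSeidel_seidelMatrix G).switchMatrix U).graph

/-- The switching class `[G]` of a graph `G`: all graphs obtained from `G` by switching. -/
def switchingClass {V : Type*} [Fintype V] [DecidableEq V] (G : SimpleGraph V) :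
    Set (SimpleGraph V) :=
  {H | ∃ U : Finset V, H = switchGraph G U}

/-- The switching class `[S]` of a Seidel matrix `S`: the switching class of its graph. -/
def IsSeidel.switchingClass {V : Type*} [Fintype V] [DecidableEq V] {S : Matrix V V ℝ}
    (hS : IsSeidel S) : Set (SimpleGraph V) :=
  _root_.switchingClass hS.graph

/-- `μ` is the smallest eigenvalue of the real square matrix `S`. -/
def IsSmallestEigenvalue {V : Type*} [Fintype V] [DecidableEq V] (S : Matrix V V ℝ) (μ : ℝ) :
    Prop :=
  IsLeast {x : ℝ | Module.End.HasEigenvalue (Matrix.toLin' S) x} μ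

/-! Switching conjugates `S` by a diagonal matrix with entries ±1, so it preserves positive
semidefiniteness and the rank of S + 5I; hence `S` may be replaced by the Seidel matrix of a graph
`G` of maximum degree at most 16. Then S + 5I = 2(2I - A) + J, with J the all-ones matrix, is
positive semidefinite. So `energy`, the form of 2I - A, is nonnegative on vectors of sum zero and
can be negative in essentially one direction only.

If `energy` is nonnegative everywhere, a Perron-Frobenius argument shows that each component of `G`
contributes at most one dimension to ker(2I - A), and only if it has at least three vertices; so
this kernel has dimension at most n/3. Now ker(S + 5I) is its subspace of sum-zero vectors, which is
proper once nonzero, since the kernel of 2I - A is closed under entrywise absolute value. This gives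
`rank_ge_of_energy_nonneg`.

Otherwise a nonnegative vector of negative energy exists, and `energyPosOn_of_energy_neg` makes the
form positive definite away from the support of any such vector and its neighbours. Choosing that
vector well, modelled on a star or on an extended Dynkin diagram of type D, yields a set `B` of at
most 91 vertices off which the form is positive definite
(`exists_energyPosOn_of_exists_energy_neg`). A vector of ker(S + 5I) is then determined by its
values on `B`, so the rank is at least n - 91 (`card_le_rank_add_card`). -/

namespace SimpleGraph

set_option linter.unusedSectionVars false

/-! ### The quadratic form of 2I - A. -/

section Energy

variable {V : Type*} [Fintype V] [DecidableEq V] (G : SimpleGraph V) [DecidableRel G.Adj]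

/-- The matrix `2 I - A(G)`. -/
def twoSubAdj : Matrix V V ℝ := (2 : ℝ) • 1 - G.adjMatrix ℝ

/-- The quadratic form of the matrix `2 I - A(G)`. -/
def energy (x : V → ℝ) : ℝ := x ⬝ᵥ (G.twoSubAdj.mulVec x)

/-- The form `energy` is positive definite on the functions supported in `s`. -/
def EnergyPosOn (s : Set V) : Prop :=
  ∀ g : V → ℝ, (∀ v, v ∉ s → g v = 0) → g ≠ 0 → 0 < G.energy g

theorem twoSubAdj_mulVec_apply (x : V → ℝ) (v : V) :
    G.twoSubAdj.mulVec x v = 2 * x v - ∑ u ∈ G.neighborFinset v, x u := by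
  simp [twoSubAdj, Matrix.sub_mulVec, Matrix.smul_mulVec]

theorem isSymm_twoSubAdj : G.twoSubAdj.IsSymm :=
  (Matrix.isSymm_one.smul 2).sub G.isSymm_adjMatrix

theorem dotProduct_twoSubAdj_comm (x y : V → ℝ) :
    x ⬝ᵥ (G.twoSubAdj.mulVec y) = y ⬝ᵥ (G.twoSubAdj.mulVec x) := by
  rw [Matrix.dotProduct_mulVec, ← Matrix.mulVec_transpose, G.isSymm_twoSubAdj.eq,
    dotProduct_comm]

theorem energy_add (x y : V → ℝ) :
    G.energy (x + y) = G.energy x + G.energy y + 2 * (x ⬝ᵥ (G.twoSubAdj.mulVec y)) := by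
  have h := G.dotProduct_twoSubAdj_comm x y
  simp only [energy, Matrix.mulVec_add, add_dotProduct, dotProduct_add]
  linarith

theorem energy_smul (c : ℝ) (x : V → ℝ) : G.energy (c • x) = c ^ 2 * G.energy x := by
  simp only [energy, Matrix.mulVec_smul, smul_dotProduct, dotProduct_smul, smul_eq_mul]
  ring

theorem energy_single (v : V) (c : ℝ) : G.energy (Pi.single v c) = 2 * c ^ 2 := by
  have h : ∑ u ∈ G.neighborFinset v, (Pi.single v c : V → ℝ) u = 0 :=
    Finset.sum_eq_zero fun u hu => by
      rw [Pi.single_eq_of_ne]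
      rintro rfl
      simp at hu
  simp only [energy, single_dotProduct, twoSubAdj_mulVec_apply, h, Pi.single_eq_same]
  ring

theorem dotProduct_twoSubAdj_eq_zero {x y : V → ℝ}
    (h : ∀ v, x v ≠ 0 → y v = 0 ∧ ∀ u, G.Adj v u → y u = 0) :
    x ⬝ᵥ (G.twoSubAdj.mulVec y) = 0 := by
  refine Finset.sum_eq_zero fun v _ => ?_
  by_cases hv : x v = 0
  · simp [hv]
  · obtain ⟨h1, h2⟩ := h v hv
    rw [twoSubAdj_mulVec_apply, h1, Finset.sum_eq_zero fun u hu => h2 u (by simpa using hu)]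
    simp

theorem energy_abs_le (x : V → ℝ) : G.energy |x| ≤ G.energy x := by
  refine Finset.sum_le_sum fun v _ => ?_
  have h : x v * ∑ u ∈ G.neighborFinset v, x u ≤ |x v| * ∑ u ∈ G.neighborFinset v, |x u| := by
    rw [Finset.mul_sum, Finset.mul_sum]
    refine Finset.sum_le_sum fun u _ => ?_
    rw [← abs_mul]
    exact le_abs_self _
  simp only [twoSubAdj_mulVec_apply, Pi.abs_apply]
  nlinarith [abs_mul_abs_self (x v)]

/-- This is the Laplacian form plus a diagonal correction; the halving is there because ordered
pairs count each edge twice. Only vertices of degree at least 3 can contribute negatively. -/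
theorem energy_eq_sum_sq (x : V → ℝ) :
    G.energy x = (∑ v, ∑ u, if G.Adj v u then (x v - x u) ^ 2 else 0) / 2 +
      ∑ v, (2 - (G.degree v : ℝ)) * x v ^ 2 := by
  rw [← lapMatrix_toLinearMap₂' ℝ G x, Matrix.toLinearMap₂'_apply', lapMatrix,
    Matrix.sub_mulVec, dotProduct_sub]
  simp only [energy, twoSubAdj, Matrix.sub_mulVec, dotProduct_sub, Matrix.smul_mulVec,
    Matrix.one_mulVec, dotProduct_smul, smul_eq_mul]
  simp only [degMatrix, Matrix.mulVec_diagonal, dotProduct]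
  rw [Finset.mul_sum]
  have : ∑ v, (2 - (G.degree v : ℝ)) * x v ^ 2 =
      ∑ v, 2 * (x v * x v) - ∑ v, x v * ((G.degree v : ℝ) * x v) := by
    rw [← Finset.sum_sub_distrib]
    exact Finset.sum_congr rfl fun v _ => by ring
  rw [this]
  ring

theorem sum_sq_diff_nonneg (x : V → ℝ) :
    0 ≤ ∑ v, ∑ u, if G.Adj v u then (x v - x u) ^ 2 else 0 :=
  Finset.sum_nonneg fun v _ => Finset.sum_nonneg fun u _ => by split_ifs <;> positivity

variable {G}

theorem energy_nonneg_of_degree_le_two {x : V → ℝ} (h : ∀ v, x v ≠ 0 → G.degree v ≤ 2) :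
    0 ≤ G.energy x := by
  rw [energy_eq_sum_sq]
  have h1 := G.sum_sq_diff_nonneg x
  have h2 : 0 ≤ ∑ v, (2 - (G.degree v : ℝ)) * x v ^ 2 := by
    refine Finset.sum_nonneg fun v _ => ?_
    by_cases hv : x v = 0
    · simp [hv]
    · have : (G.degree v : ℝ) ≤ 2 := by exact_mod_cast h v hv
      exact mul_nonneg (by linarith) (sq_nonneg _)
  linarith

/-- Nonpositive energy forces equality along every edge, and a walk leaving `s` carries the value 0
back to each vertex. -/
theorem energyPosOn_of_degree_le_two {s : Set V} (h : ∀ v ∈ s, G.degree v ≤ 2)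
    (hr : ∀ v ∈ s, ∃ w, w ∉ s ∧ G.Reachable v w) : G.EnergyPosOn s := by
  intro x hx hx0
  by_contra hneg
  apply hx0
  rw [energy_eq_sum_sq] at hneg
  have h1 := G.sum_sq_diff_nonneg x
  have h2 : 0 ≤ ∑ v, (2 - (G.degree v : ℝ)) * x v ^ 2 := by
    refine Finset.sum_nonneg fun v _ => ?_
    by_cases hv : v ∈ s
    · have : (G.degree v : ℝ) ≤ 2 := by exact_mod_cast h v hv
      exact mul_nonneg (by linarith) (sq_nonneg _)
    · simp [hx v hv]
  have h3 : ∑ v, ∑ u, (if G.Adj v u then (x v - x u) ^ 2 else 0) = 0 := by linarith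
  have hconst : ∀ v u, G.Adj v u → x v = x u := by
    intro v u hvu
    rw [Finset.sum_eq_zero_iff_of_nonneg fun v _ =>
      Finset.sum_nonneg fun u _ => by split_ifs <;> positivity] at h3
    have h4 := h3 v (Finset.mem_univ v)
    rw [Finset.sum_eq_zero_iff_of_nonneg fun u _ => by split_ifs <;> positivity] at h4
    have h5 := h4 u (Finset.mem_univ u)
    rw [if_pos hvu] at h5
    exact sub_eq_zero.mp (pow_eq_zero_iff two_ne_zero |>.mp h5)
  have hwalk : ∀ v w, G.Walk v w → x v = x w := by
    intro v w p
    induction p with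
    | nil => rfl
    | cons hadj _ ih => exact (hconst _ _ hadj).trans ih
  funext v
  by_cases hv : v ∈ s
  · obtain ⟨w, hw, ⟨p⟩⟩ := hr v hv
    rw [hwalk v w p, hx w hw, Pi.zero_apply]
  · exact hx v hv

theorem EnergyPosOn.mono {s t : Set V} (ht : G.EnergyPosOn t) (h : s ⊆ t) : G.EnergyPosOn s :=
  fun g hg => ht g fun v hv => hg v fun hs => hv (h hs)

theorem EnergyPosOn.union {s t : Set V} (hs : G.EnergyPosOn s) (ht : G.EnergyPosOn t)
    (h : ∀ v ∈ s, ∀ u ∈ t, ¬ G.Adj v u) : G.EnergyPosOn (s ∪ t) := by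
  classical
  intro g hg hg0
  set x : V → ℝ := fun v => if v ∈ s then g v else 0 with hx
  set y : V → ℝ := fun v => if v ∈ s then 0 else g v with hy
  have hxy : g = x + y := by
    funext v
    by_cases hv : v ∈ s <;> simp [hx, hy, hv]
  have hx1 : ∀ v, v ∉ s → x v = 0 := fun v hv => if_neg hv
  have hy1 : ∀ v, v ∉ t → y v = 0 := fun v hv => by
    by_cases hvs : v ∈ s
    · exact if_pos hvs
    · exact (if_neg hvs).trans (hg v fun hst => hst.elim hvs hv)
  have hdot : x ⬝ᵥ (G.twoSubAdj.mulVec y) = 0 := by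
    refine G.dotProduct_twoSubAdj_eq_zero fun v hv => ?_
    have hvs : v ∈ s := by_contra fun hvs => hv (hx1 v hvs)
    exact ⟨if_pos hvs, fun u hu => hy1 u fun hut => h v hvs u hut hu⟩
  rw [hxy, energy_add, hdot]
  by_cases hx0 : x = 0
  · have hy0 : y ≠ 0 := fun hy0 => hg0 (by rw [hxy, hx0, hy0, add_zero])
    have := ht y hy1 hy0
    have h0 : G.energy 0 = 0 := by simp [energy]
    rw [hx0, h0]
    linarith
  · have h1 := hs x hx1 hx0
    have h2 : 0 ≤ G.energy y := by
      by_cases hy0 : y = 0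
      · simp [energy, hy0]
      · exact (ht y hy1 hy0).le
    linarith

theorem energyPosOn_singleton (v : V) : G.EnergyPosOn {v} := by
  intro g hg hg0
  have hgv : g = Pi.single v (g v) := by
    funext u
    by_cases hu : u = v
    · subst hu; simp
    · rw [Pi.single_eq_of_ne hu, hg u hu]
  have hne : g v ≠ 0 := fun h0 => hg0 (by rw [hgv, h0, Pi.single_zero])
  rw [hgv, energy_single]
  positivity

/-! ### Consequences of semidefiniteness when some vector has negative energy. -/

/-- The matrix `2 (2 I - A) + J` is positive semidefinite. -/
def TwoSubAdjAddOnesNonneg (G : SimpleGraph V) [DecidableRel G.Adj] : Prop :=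
  ∀ x : V → ℝ, 0 ≤ 2 * G.energy x + (∑ v, x v) ^ 2

theorem sum_pos_of_nonneg_of_ne_zero {x : V → ℝ} (hx : 0 ≤ x) (hx0 : x ≠ 0) : 0 < ∑ v, x v := by
  obtain ⟨v, hv⟩ := Function.ne_iff.mp hx0
  exact Finset.sum_pos' (fun u _ => hx u) ⟨v, Finset.mem_univ v, (hx v).lt_of_ne (Ne.symm hv)⟩

/-- If `g` had nonpositive energy, so would `|g|`. The combination of `x` and `|g|` with total sum
zero has no cross term, because the supports are disjoint and non-adjacent, so its energy would be
negative, contradicting `hM`. -/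
theorem energyPosOn_of_energy_neg (hM : G.TwoSubAdjAddOnesNonneg) {x : V → ℝ} (hx : 0 ≤ x)
    (hneg : G.energy x < 0) {s : Set V}
    (hs : ∀ v ∈ s, x v = 0 ∧ ∀ u, G.Adj v u → x u = 0) : G.EnergyPosOn s := by
  intro g hg hg0
  by_contra hle
  have hx0 : x ≠ 0 := by
    rintro rfl
    simp [energy] at hneg
  have ha := G.energy_abs_le g
  have h1 := sum_pos_of_nonneg_of_ne_zero hx hx0
  have h2 := sum_pos_of_nonneg_of_ne_zero (abs_nonneg g) 
    (fun h => hg0 (funext fun v => abs_eq_zero.mp (congrFun h v)))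
  set a := ∑ v, x v
  set b := ∑ v, |g| v
  have hdot : (-a • |g|) ⬝ᵥ (G.twoSubAdj.mulVec (b • x)) = 0 := by
    refine G.dotProduct_twoSubAdj_eq_zero fun v hv => ?_
    have hvs : v ∈ s := by
      by_contra hvs
      simp [hg v hvs] at hv
    obtain ⟨h3, h4⟩ := hs v hvs
    exact ⟨by simp [h3], fun u hu => by simp [h4 u hu]⟩
  have h5 := hM (-a • |g| + b • x)
  have h6 : ∑ v, (-a • |g| + b • x) v = 0 := by
    simp only [Pi.add_apply, Pi.smul_apply, smul_eq_mul, Finset.sum_add_distrib,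
      ← Finset.mul_sum]
    change -a * b + b * a = 0
    ring
  rw [energy_add, hdot, energy_smul, energy_smul, h6] at h5
  have h7 : 0 < b ^ 2 := by positivity
  nlinarith [mul_neg_of_pos_of_neg h7 hneg,
    mul_nonneg (sq_nonneg a) (by linarith : 0 ≤ -G.energy |g|)]

/-- This replaces an unknown vector `x` of negative energy, with uncontrolled support, by an
explicit `f` changed at a single vertex. -/
theorem exists_energy_neg_of_mulVec_nonpos (hM : G.TwoSubAdjAddOnesNonneg) {x f : V → ℝ}
    (hneg : G.energy x < 0) (hf : 0 ≤ f) (hf0 : f ≠ 0)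
    (hsub : ∀ v, G.twoSubAdj.mulVec f v ≤ 0) :
    ∃ (w : V) (c : ℝ), 0 ≤ c ∧ G.energy (f + Pi.single w c) < 0 := by
  by_cases hharm : G.twoSubAdj.mulVec f = 0
  -- If `f` lies in the kernel, adding a multiple of it to `x` makes the sum zero without affecting
  -- the sign of the energy.
  · exfalso
    have h1 := sum_pos_of_nonneg_of_ne_zero hf hf0
    set a := ∑ v, f v
    set b := ∑ v, x v
    have h5 := hM (a • x + -b • f)
    have h6 : ∑ v, (a • x + -b • f) v = 0 := by
      simp only [Pi.add_apply, Pi.smul_apply, smul_eq_mul, Finset.sum_add_distrib,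
        ← Finset.mul_sum]
      change a * b + -b * a = 0
      ring
    have h7 : G.energy f = 0 := by simp [energy, hharm]
    rw [energy_add, Matrix.mulVec_smul, hharm, energy_smul, energy_smul, h6, h7] at h5
    have h8 : 0 < a ^ 2 := by positivity
    simp only [smul_zero, dotProduct_zero] at h5
    nlinarith [mul_neg_of_pos_of_neg h8 hneg]
  · obtain ⟨w, hw⟩ := Function.ne_iff.mp hharm
    have hw' : G.twoSubAdj.mulVec f w < 0 := (hsub w).lt_of_ne hw
    -- With t the negative value at `w`, adding c at `w` changes the energy by 2c² + 2tc; this c =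
    -- -t/2 minimises it, giving -t²/2.
    refine ⟨w, -(G.twoSubAdj.mulVec f w) / 2, by linarith, ?_⟩
    have hE : G.energy f ≤ 0 :=
      Finset.sum_nonpos fun v _ => mul_nonpos_of_nonneg_of_nonpos (hf v) (hsub v)
    rw [energy_add, energy_single, dotProduct_twoSubAdj_comm, single_dotProduct]
    nlinarith [mul_pos_of_neg_of_neg hw' hw']

/-! ### Weights of extended Dynkin diagrams of type D. -/

/-- The function that is `2` on `P`, `1` on `L` and `0` elsewhere. -/
def twoOneWeight (P L : Finset V) (v : V) : ℝ :=
  (if v ∈ P then 2 else 0) + (if v ∈ L then 1 else 0)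

theorem twoOneWeight_nonneg (P L : Finset V) : 0 ≤ twoOneWeight P L := fun v => by
  simp only [twoOneWeight, Pi.zero_apply]
  split_ifs <;> norm_num

theorem twoOneWeight_ne_zero {P : Finset V} (L : Finset V) {v : V} (hv : v ∈ P) :
    twoOneWeight P L ≠ 0 := by
  refine Function.ne_iff.mpr ⟨v, ?_⟩
  simp only [twoOneWeight, hv, if_true, Pi.zero_apply]
  split_ifs <;> norm_num

theorem twoOneWeight_eq_zero {P L : Finset V} {v : V} (hP : v ∉ P) (hL : v ∉ L) :
    twoOneWeight P L v = 0 := by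
  simp [twoOneWeight, hP, hL]

theorem twoSubAdj_mulVec_twoOneWeight (P L : Finset V) (v : V) :
    G.twoSubAdj.mulVec (twoOneWeight P L) v = 2 * twoOneWeight P L v -
      (2 * ((G.neighborFinset v ∩ P).card : ℝ) + ((G.neighborFinset v ∩ L).card : ℝ)) := by
  rw [twoSubAdj_mulVec_apply]
  simp only [twoOneWeight, Finset.sum_add_distrib, Finset.sum_ite_mem, Finset.sum_const,
    nsmul_eq_mul]
  ring

/-- Only lower bounds on neighbour counts are needed: extra edges among `P` and `L` just decrease
the value, so the configuration need not be an induced subgraph. -/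
theorem twoSubAdj_mulVec_twoOneWeight_nonpos {P L : Finset V} (hPL : Disjoint P L)
    (hP : ∀ v ∈ P, 4 ≤ 2 * (G.neighborFinset v ∩ P).card + (G.neighborFinset v ∩ L).card)
    (hL : ∀ v ∈ L, ∃ u ∈ P, G.Adj v u) (v : V) :
    G.twoSubAdj.mulVec (twoOneWeight P L) v ≤ 0 := by
  rw [twoSubAdj_mulVec_twoOneWeight]
  by_cases hvP : v ∈ P
  · have h1 : ((4 : ℕ) : ℝ) ≤ _ := Nat.cast_le.mpr (hP v hvP)
    push_cast at h1
    simp only [twoOneWeight, hvP, Finset.disjoint_left.mp hPL hvP, if_true, if_false]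
    linarith
  · by_cases hvL : v ∈ L
    · obtain ⟨u, huP, hu⟩ := hL v hvL
      have h1 : 1 ≤ (G.neighborFinset v ∩ P).card :=
        Finset.card_pos.mpr ⟨u, by simp [hu, huP]⟩
      have h2 : (1 : ℝ) ≤ (G.neighborFinset v ∩ P).card := by exact_mod_cast h1
      simp only [twoOneWeight, hvP, hvL, if_true, if_false]
      have h3 : (0 : ℝ) ≤ (G.neighborFinset v ∩ L).card := Nat.cast_nonneg _
      linarith
    · rw [twoOneWeight_eq_zero hvP hvL]
      have h3 : (0 : ℝ) ≤ (G.neighborFinset v ∩ L).card := Nat.cast_nonneg _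
      have h4 : (0 : ℝ) ≤ (G.neighborFinset v ∩ P).card := Nat.cast_nonneg _
      linarith

variable (G) in
/-- The union of the closed neighbourhoods of the vertices of `Y`. -/
def closedNbhd (Y : Finset V) : Finset V := Y.biUnion fun v => insert v (G.neighborFinset v)

theorem mem_closedNbhd {Y : Finset V} {v : V} :
    v ∈ G.closedNbhd Y ↔ ∃ u ∈ Y, v = u ∨ G.Adj u v := by
  simp [closedNbhd]

theorem card_closedNbhd_le {d : ℕ} (hd : ∀ v, G.degree v ≤ d) (Y : Finset V) :
    (G.closedNbhd Y).card ≤ Y.card * (d + 1) :=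
  Finset.card_biUnion_le_card_mul _ _ _ fun v _ =>
    (Finset.card_insert_le _ _).trans (Nat.succ_le_succ (hd v))

/-- If a nonnegative function of negative energy is supported in `Y ∪ I`, where `I` is positive
and its neighbours lie in `I` or in `Y`, then positivity holds off the closed neighbourhood of
`Y`. -/
theorem energyPosOn_compl_closedNbhd (hM : G.TwoSubAdjAddOnesNonneg) {x : V → ℝ} (hx : 0 ≤ x)
    (hneg : G.energy x < 0) {Y : Finset V} {I : Set V} (hsupp : ∀ v, v ∉ Y → v ∉ I → x v = 0)
    (hI : G.EnergyPosOn I) (hnbr : ∀ v ∈ I, ∀ u, G.Adj v u → u ∈ Y ∨ u ∈ I) :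
    G.EnergyPosOn ((G.closedNbhd Y : Set V)ᶜ) := by
  have hYc : ∀ v ∈ Y, v ∈ G.closedNbhd Y := fun v hv => mem_closedNbhd.mpr ⟨v, hv, Or.inl rfl⟩
  -- No vertex of `R` lies in or next to the support of `x`, and no edge joins `R` to `I`; so
  -- positivity on `R` and on `I` combine.
  set R : Set V := {v | v ∉ G.closedNbhd Y ∧ v ∉ I} with hR
  have hRpos : G.EnergyPosOn R := by
    refine energyPosOn_of_energy_neg hM hx hneg fun v hv => ⟨?_, fun u hu => ?_⟩
    · exact hsupp v (fun hvY => hv.1 (hYc v hvY)) hv.2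
    · refine hsupp u (fun huY => hv.1 (mem_closedNbhd.mpr ⟨u, huY, Or.inr hu.symm⟩)) fun huI => ?_
      rcases hnbr u huI v hu.symm with h | h
      · exact hv.1 (hYc v h)
      · exact hv.2 h
  refine (hI.union hRpos fun v hv u hu huv => ?_).mono fun v hv => ?_
  · rcases hnbr v hv u huv with h | h
    · exact hu.1 (hYc u h)
    · exact hu.2 h
  · by_cases hvI : v ∈ I
    · exact Or.inl hvI
    · exact Or.inr ⟨hv, hvI⟩

/-! ### Graphs with a vertex of degree at least four. -/

/-- A star with five leaves, weighted 2 at the centre and 1 at the leaves, already has negative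
energy. -/
theorem exists_energyPosOn_of_five_le_degree (hM : G.TwoSubAdjAddOnesNonneg)
    (hd : ∀ v, G.degree v ≤ 16) {v : V} (hv : 5 ≤ G.degree v) :
    ∃ B : Finset V, B.card ≤ 91 ∧ G.EnergyPosOn ((B : Set V)ᶜ) := by
  obtain ⟨L, hLsub, hLcard⟩ := Finset.exists_subset_card_eq (s := G.neighborFinset v) hv
  have hvL : v ∉ L := fun h => by simpa using hLsub h
  have hLadj : ∀ l ∈ L, G.Adj v l := fun l hl => by simpa using hLsub hl
  have hinter : G.neighborFinset v ∩ L = L := Finset.inter_eq_right.mpr hLsub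
  set f := twoOneWeight {v} L
  have hf := twoOneWeight_nonneg {v} L
  have hsub : ∀ u, G.twoSubAdj.mulVec f u ≤ 0 := by
    refine twoSubAdj_mulVec_twoOneWeight_nonpos (Finset.disjoint_singleton_left.mpr hvL) ?_ ?_
    · intro u hu
      rw [Finset.mem_singleton.mp hu, hinter, hLcard]
      omega
    · exact fun l hl => ⟨v, Finset.mem_singleton_self v, (hLadj l hl).symm⟩
  have hneg : G.energy f < 0 := by
    refine Finset.sum_neg' (fun u _ => mul_nonpos_of_nonneg_of_nonpos (hf u) (hsub u))
      ⟨v, Finset.mem_univ v, ?_⟩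
    have h1 : f v = 2 := by simp [f, twoOneWeight, hvL]
    have h2 : G.twoSubAdj.mulVec f v ≤ -1 := by
      rw [twoSubAdj_mulVec_twoOneWeight, hinter, hLcard]
      change 2 * f v - _ ≤ _
      rw [h1]
      have h4 : (0 : ℝ) ≤ (G.neighborFinset v ∩ {v}).card := Nat.cast_nonneg _
      push_cast
      linarith
    rw [h1]
    linarith
  -- The centre `v` is left out of `B`: all its neighbours are in `B`, so it is isolated in the
  -- complement. The count is at most 16 + 5 · 15 = 91.
  set B : Finset V := G.neighborFinset v ∪ L.biUnion fun l => (G.neighborFinset l).erase v with hB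
  refine ⟨B, ?_, ?_⟩
  · have h1 : (L.biUnion fun l => (G.neighborFinset l).erase v).card ≤ L.card * 15 := by
      refine Finset.card_biUnion_le_card_mul _ _ _ fun l hl => ?_
      rw [Finset.card_erase_of_mem (by simpa using (hLadj l hl).symm)]
      have : (G.neighborFinset l).card ≤ 16 := hd l
      omega
    have h2 : (G.neighborFinset v).card ≤ 16 := hd v
    exact (Finset.card_union_le _ _).trans (by omega)
  · have hsupp : ∀ u, u ≠ v → u ∉ L → f u = 0 := fun u huv huL =>
      twoOneWeight_eq_zero (by simpa using huv) huL
    have hR : G.EnergyPosOn {u | u ∉ B ∧ u ≠ v} := by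
      refine energyPosOn_of_energy_neg hM hf hneg fun u hu => ⟨?_, fun w hw => ?_⟩
      · exact hsupp u hu.2 fun huL => hu.1 (Finset.mem_union_left _ (hLsub huL))
      · refine hsupp w ?_ fun hwL => ?_
        · rintro rfl
          exact hu.1 (Finset.mem_union_left _ (by simpa using hw.symm))
        · exact hu.1 (Finset.mem_union_right _ (Finset.mem_biUnion.mpr
            ⟨w, hwL, by simp [hu.2, hw.symm]⟩))
    refine ((energyPosOn_singleton v).union hR fun u hu w hw huw => ?_).mono fun u hu => ?_
    · rw [Set.mem_singleton_iff.mp hu] at huw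
      exact hw.1 (Finset.mem_union_left _ (by simpa using huw))
    · by_cases huv : u = v
      · exact Or.inl huv
      · exact Or.inr ⟨hu, huv⟩

/-- A star with four leaves is the borderline case, so one more vertex `w` is needed to make the
energy negative. The six vertices involved have closed neighbourhoods of size at most 5. -/
theorem exists_energyPosOn_of_degree_eq_four (hM : G.TwoSubAdjAddOnesNonneg)
    (hd : ∀ v, G.degree v ≤ 4) {x : V → ℝ} (hneg : G.energy x < 0) {v : V}
    (hv : G.degree v = 4) :
    ∃ B : Finset V, B.card ≤ 91 ∧ G.EnergyPosOn ((B : Set V)ᶜ) := by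
  obtain ⟨w, c, hc, hE⟩ := exists_energy_neg_of_mulVec_nonpos hM hneg
    (twoOneWeight_nonneg {v} (G.neighborFinset v))
    (twoOneWeight_ne_zero _ (Finset.mem_singleton_self v))
    (twoSubAdj_mulVec_twoOneWeight_nonpos (by simp)
      (fun u hu => by
        rw [Finset.mem_singleton.mp hu, Finset.inter_self, card_neighborFinset_eq_degree, hv]
        omega)
      (fun l hl => ⟨v, Finset.mem_singleton_self v,
        by simpa using (mem_neighborFinset _ _ _ |>.mp hl).symm⟩))
  refine ⟨G.closedNbhd (insert w (insert v (G.neighborFinset v))), ?_,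
    energyPosOn_compl_closedNbhd hM (add_nonneg (twoOneWeight_nonneg _ _)
      (Pi.single_nonneg.mpr hc)) hE (I := ∅) ?_ ?_ (by simp)⟩
  · have h1 := card_closedNbhd_le hd (insert w (insert v (G.neighborFinset v)))
    have h2 := Finset.card_insert_le w (insert v (G.neighborFinset v))
    have h3 := Finset.card_insert_le v (G.neighborFinset v)
    rw [card_neighborFinset_eq_degree, hv] at h3
    omega
  · intro u hu _
    simp only [Finset.mem_insert, not_or] at hu
    rw [Pi.add_apply, Pi.single_eq_of_ne hu.1,
      twoOneWeight_eq_zero (by simpa using hu.2.1) hu.2.2, add_zero]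
  · exact fun g hg hg0 => absurd (funext fun u => hg u (Set.notMem_empty u)) hg0

end Energy

/-! ### Graphs of maximum degree three, and the combined bound. -/

section DegreeThree

variable {V : Type*} [Fintype V] [DecidableEq V] {G : SimpleGraph V} [DecidableRel G.Adj]

/-- A shortest path between two vertices of degree at least three. -/
theorem exists_shortest_path_between_branches
    (h : ∃ u w : V, u ≠ w ∧ 3 ≤ G.degree u ∧ 3 ≤ G.degree w ∧ G.Reachable u w) :
    ∃ (u w : V) (p : G.Walk u w), u ≠ w ∧ 3 ≤ G.degree u ∧ 3 ≤ G.degree w ∧ p.IsPath ∧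
      ∀ v ∈ p.support, v ≠ u → v ≠ w → G.degree v ≤ 2 := by
  have hex : ∃ (k : ℕ) (u w : V) (p : G.Walk u w),
      u ≠ w ∧ 3 ≤ G.degree u ∧ 3 ≤ G.degree w ∧ p.length = k := by
    obtain ⟨u, w, huw, hu, hw, ⟨p⟩⟩ := h
    exact ⟨_, u, w, p, huw, hu, hw, rfl⟩
  classical
  obtain ⟨u, w, p, huw, hu, hw, hp⟩ := Nat.find_spec hex
  -- The length is minimal over all pairs of distinct branch vertices, so an inner branch vertex
  -- would give a shorter walk from `u`.
  have hmin : ∀ v ∈ p.bypass.support, v ≠ u → v ≠ w → G.degree v ≤ 2 := by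
    intro v hv hvu hvw
    by_contra hdeg
    have h1 := p.bypass.length_takeUntil_lt_length hv hvw
    have h2 := p.length_bypass_le_length
    exact Nat.find_min hex (m := (p.bypass.takeUntil v hv).length) (by omega)
      ⟨u, v, p.bypass.takeUntil v hv, hvu.symm, hu, by omega, rfl⟩
  exact ⟨u, w, p.bypass, huw, hu, hw, p.bypass_isPath, hmin⟩

/-- An inner vertex of a path has at least two neighbours on the path. -/
theorem two_le_card_neighborFinset_inter_support {u w : V} {p : G.Walk u w} (hp : p.IsPath) {v : V}
    (hv : v ∈ p.support) (hvu : v ≠ u) (hvw : v ≠ w) :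
    2 ≤ (G.neighborFinset v ∩ p.support.toFinset).card := by
  obtain ⟨i, rfl, hi⟩ := Walk.mem_support_iff_exists_getVert.mp hv
  have hi0 : i ≠ 0 := by
    rintro rfl
    simp at hvu
  have hil : i ≠ p.length := by
    rintro rfl
    simp at hvw
  have hadj1 := p.adj_getVert_succ (i := i - 1) (by omega)
  rw [Nat.sub_add_cancel (by omega)] at hadj1
  have hadj2 := p.adj_getVert_succ (i := i) (by omega)
  have hne : p.getVert (i - 1) ≠ p.getVert (i + 1) := fun h => by
    have := hp.getVert_injOn (show i - 1 ≤ p.length by omega) (show i + 1 ≤ p.length by omega) h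
    omega
  rw [← Finset.card_pair hne]
  refine Finset.card_le_card fun z hz => ?_
  rcases Finset.mem_insert.mp hz with rfl | hz
  · simp [hadj1.symm, Walk.getVert_mem_support]
  · rw [Finset.mem_singleton.mp hz]
    simp [hadj2, Walk.getVert_mem_support]

/-- The weights are 2 on a shortest path between two branch vertices and 1 on the remaining
neighbours of its ends. The path may be arbitrarily long, so its interior `I` must stay out of `B`;
this is possible because inner vertices have degree 2 and all their neighbours on the path, making
the form positive definite on `I`. -/
theorem exists_energyPosOn_of_two_branches (hM : G.TwoSubAdjAddOnesNonneg)
    (hd : ∀ v, G.degree v ≤ 3) {x : V → ℝ} (hneg : G.energy x < 0)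
    (h : ∃ u w : V, u ≠ w ∧ 3 ≤ G.degree u ∧ 3 ≤ G.degree w ∧ G.Reachable u w) :
    ∃ B : Finset V, B.card ≤ 91 ∧ G.EnergyPosOn ((B : Set V)ᶜ) := by
  obtain ⟨u, w, p, huw, hu, hw, hp, hinner⟩ := exists_shortest_path_between_branches h
  set P : Finset V := p.support.toFinset with hP
  have huP : u ∈ P := by simp [hP]
  have hwP : w ∈ P := by simp [hP]
  set N : Finset V := G.neighborFinset u ∪ G.neighborFinset w with hN
  have hsplit : ∀ v, G.neighborFinset v ⊆ N →
      G.degree v = (G.neighborFinset v ∩ P).card + (G.neighborFinset v ∩ (N \ P)).card := by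
    intro v hv
    rw [← card_neighborFinset_eq_degree, ← Finset.card_inter_add_card_sdiff (G.neighborFinset v) P]
    congr 2
    ext z
    simp only [Finset.mem_sdiff, Finset.mem_inter]
    exact ⟨fun hz => ⟨hz.1, hv hz.1, hz.2⟩, fun hz => ⟨hz.1, hz.2.2⟩⟩
  have hpn : ¬ p.Nil := fun hnil => huw hnil.eq
  have hu1 : 1 ≤ (G.neighborFinset u ∩ P).card :=
    Finset.card_pos.mpr ⟨p.snd, by simp [hP, p.adj_snd hpn]⟩
  have hw1 : 1 ≤ (G.neighborFinset w ∩ P).card :=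
    Finset.card_pos.mpr ⟨p.penultimate, by simp [hP, (p.adj_penultimate hpn).symm]⟩
  have hsub := twoSubAdj_mulVec_twoOneWeight_nonpos (G := G) (P := P) (L := N \ P)
    Finset.disjoint_sdiff
    (fun v hv => by
      by_cases hvu : v = u
      · subst hvu
        have := hsplit v Finset.subset_union_left
        omega
      · by_cases hvw : v = w
        · subst hvw
          have := hsplit v Finset.subset_union_right
          omega
        · have := two_le_card_neighborFinset_inter_support hp (by simpa [hP] using hv) hvu hvw
          change 2 ≤ (G.neighborFinset v ∩ P).card at this
          omega)
    (fun v hv => by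
      rcases Finset.mem_union.mp (Finset.mem_sdiff.mp hv).1 with h1 | h1
      · exact ⟨u, huP, by simpa using (mem_neighborFinset _ _ _ |>.mp h1).symm⟩
      · exact ⟨w, hwP, by simpa using (mem_neighborFinset _ _ _ |>.mp h1).symm⟩)
  obtain ⟨z, c, hc, hE⟩ := exists_energy_neg_of_mulVec_nonpos hM hneg
    (twoOneWeight_nonneg P (N \ P)) (twoOneWeight_ne_zero _ huP) hsub
  set I : Set V := {v | v ∈ P ∧ v ≠ u ∧ v ≠ w} with hI
  have hIdeg : ∀ v ∈ I, G.degree v ≤ 2 := fun v hv =>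
    hinner v (by simpa [hP] using hv.1) hv.2.1 hv.2.2
  have hInbr : ∀ v ∈ I, ∀ y, G.Adj v y → y ∈ P := by
    intro v hv y hy
    have h2 := two_le_card_neighborFinset_inter_support hp (by simpa [hP] using hv.1) hv.2.1 hv.2.2
    have h3 : G.neighborFinset v ∩ P = G.neighborFinset v :=
      Finset.eq_of_subset_of_card_le Finset.inter_subset_left ((hIdeg v hv).trans h2)
    have h4 : y ∈ G.neighborFinset v ∩ P := by
      rw [h3]
      simpa using hy
    exact (Finset.mem_inter.mp h4).2
  have hIpos : G.EnergyPosOn I := by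
    refine energyPosOn_of_degree_le_two hIdeg fun v hv => ⟨u, fun h => h.2.1 rfl, ?_⟩
    exact ⟨(p.takeUntil v (by simpa [hP] using hv.1)).reverse⟩
  -- At most 3 + 6 = 9 vertices, each with a closed neighbourhood of size at most 4.
  set Y : Finset V := insert z (insert u (insert w N)) with hY
  refine ⟨G.closedNbhd Y, ?_, energyPosOn_compl_closedNbhd hM
    (add_nonneg (twoOneWeight_nonneg _ _) (Pi.single_nonneg.mpr hc)) hE (I := I) ?_ hIpos ?_⟩
  · have h1 := card_closedNbhd_le hd Y
    have h2 : Y.card ≤ 9 := by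
      have h3 := Finset.card_insert_le z (insert u (insert w N))
      have h4 := Finset.card_insert_le u (insert w N)
      have h5 := Finset.card_insert_le w N
      have h6 : N.card ≤ G.degree u + G.degree w := Finset.card_union_le _ _
      have h7 := hd u
      have h8 := hd w
      rw [hY]
      omega
    omega
  · intro v hvY hvI
    simp only [hY, Finset.mem_insert, not_or] at hvY
    have hvP : v ∉ P := fun hvP => hvI ⟨hvP, hvY.2.1, hvY.2.2.1⟩
    rw [Pi.add_apply, Pi.single_eq_of_ne hvY.1, twoOneWeight_eq_zero hvP
      (fun hv => hvY.2.2.2 (Finset.mem_sdiff.mp hv).1), add_zero]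
  · intro v hv y hy
    have hyP := hInbr v hv y hy
    by_cases hyu : y = u
    · exact Or.inl (by simp [hY, hyu])
    · by_cases hyw : y = w
      · exact Or.inl (by simp [hY, hyw])
      · exact Or.inr ⟨hyP, hyu, hyw⟩

/-- Some connected component carries a function of negative energy. -/
theorem exists_connectedComponent_energy_neg {x : V → ℝ} (hneg : G.energy x < 0) :
    ∃ (C : G.ConnectedComponent) (y : V → ℝ), (0 ≤ x → 0 ≤ y) ∧
      (∀ v, G.connectedComponentMk v ≠ C → y v = 0) ∧ G.energy y < 0 := by
  classical
  set r : G.ConnectedComponent → V → ℝ :=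
    fun C v => if G.connectedComponentMk v = C then x v else 0 with hr
  -- No edge joins distinct components, so the energies of the restrictions add up to that of `x`.
  have hE : ∀ C, G.energy (r C) =
      ∑ v, if G.connectedComponentMk v = C then x v * G.twoSubAdj.mulVec x v else 0 := by
    intro C
    refine Finset.sum_congr rfl fun v _ => ?_
    by_cases hv : G.connectedComponentMk v = C
    · have h1 : ∑ u ∈ G.neighborFinset v, r C u = ∑ u ∈ G.neighborFinset v, x u := by
        refine Finset.sum_congr rfl fun u hu => if_pos ?_
        rw [← hv]
        exact (ConnectedComponent.connectedComponentMk_eq_of_adj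
          (mem_neighborFinset _ _ _ |>.mp hu)).symm
      rw [twoSubAdj_mulVec_apply, twoSubAdj_mulVec_apply, h1]
      simp [hr, hv]
    · simp [hr, hv]
  have hsum : ∑ C, G.energy (r C) = G.energy x := by
    simp_rw [hE]
    rw [Finset.sum_comm]
    simp [energy, dotProduct]
  obtain ⟨C, _, hC⟩ := Finset.exists_lt_of_sum_lt (s := Finset.univ) (f := fun C => G.energy (r C))
    (g := fun _ => (0 : ℝ)) (by rw [hsum]; simpa using hneg)
  refine ⟨C, r C, fun hx v => ?_, fun v hv => if_neg hv, hC⟩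
  simp only [hr]
  split_ifs
  · exact hx v
  · exact le_rfl

/-- A component `C` carrying negative energy has exactly one branch vertex `v`, and deleting `v`
suffices: the rest of `C` has degrees at most 2, and the other components are not adjacent to the
support. -/
theorem exists_energyPosOn_of_isolated_branches (hM : G.TwoSubAdjAddOnesNonneg) {x : V → ℝ}
    (hx : 0 ≤ x) (hneg : G.energy x < 0)
    (h : ∀ u w : V, 3 ≤ G.degree u → 3 ≤ G.degree w → G.Reachable u w → u = w) :
    ∃ B : Finset V, B.card ≤ 91 ∧ G.EnergyPosOn ((B : Set V)ᶜ) := by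
  obtain ⟨C, y, hy, hyC, hE⟩ := exists_connectedComponent_energy_neg hneg
  obtain ⟨v, hyv, hv⟩ : ∃ v, y v ≠ 0 ∧ 3 ≤ G.degree v := by
    by_contra! hno
    exact absurd (energy_nonneg_of_degree_le_two fun v hv => Nat.le_of_lt_succ (hno v hv))
      (not_le.mpr hE)
  have hvC : G.connectedComponentMk v = C := by_contra fun hvC => hyv (hyC v hvC)
  have hout : G.EnergyPosOn {u | G.connectedComponentMk u ≠ C} := by
    refine energyPosOn_of_energy_neg hM (hy hx) hE fun u hu => ⟨hyC u hu, fun w hw => hyC w ?_⟩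
    rw [← ConnectedComponent.connectedComponentMk_eq_of_adj hw]
    exact hu
  have hin : G.EnergyPosOn {u | G.connectedComponentMk u = C ∧ u ≠ v} := by
    refine energyPosOn_of_degree_le_two (fun u hu => ?_) fun u hu => ⟨v, fun h => h.2 rfl, ?_⟩
    · by_contra hdeg
      exact hu.2 (h u v (by omega) hv (ConnectedComponent.exact (hu.1.trans hvC.symm)))
    · exact ConnectedComponent.exact (hu.1.trans hvC.symm)
  refine ⟨{v}, by simp, (hout.union hin fun u hu w hw huw => hu ?_).mono fun u hu => ?_⟩
  · rw [ConnectedComponent.connectedComponentMk_eq_of_adj huw]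
    exact hw.1
  · by_cases huC : G.connectedComponentMk u = C
    · exact Or.inr ⟨huC, by simpa using hu⟩
    · exact Or.inl huC

theorem exists_energyPosOn_of_exists_energy_neg (hM : G.TwoSubAdjAddOnesNonneg)
    (hd : ∀ v, G.degree v ≤ 16) (hneg : ∃ x, G.energy x < 0) :
    ∃ B : Finset V, B.card ≤ 91 ∧ G.EnergyPosOn ((B : Set V)ᶜ) := by
  obtain ⟨x₀, hx₀⟩ := hneg
  have hx : 0 ≤ |x₀| := abs_nonneg x₀
  have hE : G.energy |x₀| < 0 := (G.energy_abs_le x₀).trans_lt hx₀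
  by_cases h5 : ∃ v, 5 ≤ G.degree v
  · obtain ⟨v, hv⟩ := h5
    exact exists_energyPosOn_of_five_le_degree hM hd hv
  push Not at h5
  by_cases h4 : ∃ v, G.degree v = 4
  · obtain ⟨v, hv⟩ := h4
    exact exists_energyPosOn_of_degree_eq_four hM (fun v => Nat.le_of_lt_succ (h5 v)) hE hv
  push Not at h4
  have h3 : ∀ v, G.degree v ≤ 3 := fun v => by
    have := h5 v
    have := h4 v
    omega
  by_cases h2 : ∃ u w : V, u ≠ w ∧ 3 ≤ G.degree u ∧ 3 ≤ G.degree w ∧ G.Reachable u w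
  · exact exists_energyPosOn_of_two_branches hM h3 hE h2
  · exact exists_energyPosOn_of_isolated_branches hM hx hE fun u w hu hw huw =>
      by_contra fun hne => h2 ⟨u, w, hne, hu, hw, huw⟩

end DegreeThree

/-! ### From the quadratic form to the rank. -/

section Rank

variable {V : Type*} [Fintype V] [DecidableEq V] {G : SimpleGraph V} [DecidableRel G.Adj]

theorem seidelMatrix_add_five_mulVec (x : V → ℝ) :
    (seidelMatrix G + (5 : ℝ) • 1).mulVec x =
      (2 : ℝ) • G.twoSubAdj.mulVec x + fun _ => ∑ v, x v := by
  funext v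
  have hJ : (Matrix.of (fun _ _ => (1 : ℝ)) : Matrix V V ℝ).mulVec x v = ∑ v, x v := by
    simp [Matrix.mulVec, dotProduct]
  have hA : ((G.adjMatrix ℝ).mulVec x) v = ∑ u ∈ G.neighborFinset v, x u := by simp
  have h1 : (seidelMatrix G + (5 : ℝ) • 1) =
      Matrix.of (fun _ _ => (1 : ℝ)) + (4 : ℝ) • 1 - (2 : ℝ) • G.adjMatrix ℝ := by
    have : seidelMatrix G =
        Matrix.of (fun _ _ => (1 : ℝ)) - 1 - (2 : ℝ) • G.adjMatrix ℝ := by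
      unfold seidelMatrix
      congr!
    rw [this]
    module
  rw [h1, Matrix.sub_mulVec, Matrix.add_mulVec, Matrix.smul_mulVec, Matrix.smul_mulVec,
    Matrix.one_mulVec]
  simp only [Pi.sub_apply, Pi.add_apply, Pi.smul_apply, hJ, hA, twoSubAdj_mulVec_apply,
    smul_eq_mul]
  ring

theorem dotProduct_seidelMatrix_add_five_mulVec (x : V → ℝ) :
    x ⬝ᵥ (seidelMatrix G + (5 : ℝ) • 1).mulVec x = 2 * G.energy x + (∑ v, x v) ^ 2 := by
  rw [seidelMatrix_add_five_mulVec, dotProduct_add, dotProduct_smul, smul_eq_mul]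
  congr 1
  simp only [dotProduct, ← Finset.sum_mul]
  ring

theorem rank_add_finrank_ker (A : Matrix V V ℝ) :
    A.rank + Module.finrank ℝ (LinearMap.ker A.mulVecLin) = Fintype.card V := by
  rw [Matrix.rank, LinearMap.finrank_range_add_finrank_ker, Module.finrank_fintype_fun_eq_card]

theorem finrank_ker_le_of_injective {ι : Type*} [Fintype ι] (A : Matrix V V ℝ) (f : ι → V)
    (h : ∀ x, A.mulVec x = 0 → (∀ i, x (f i) = 0) → x = 0) :
    Module.finrank ℝ (LinearMap.ker A.mulVecLin) ≤ Fintype.card ι := by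
  let φ : LinearMap.ker A.mulVecLin →ₗ[ℝ] (ι → ℝ) :=
    LinearMap.funLeft ℝ ℝ f ∘ₗ (LinearMap.ker A.mulVecLin).subtype
  have hφ : Function.Injective φ := by
    rw [← LinearMap.ker_eq_bot, LinearMap.ker_eq_bot']
    rintro ⟨x, hx⟩ hx0
    exact Subtype.ext (h x (by simpa using hx) fun i => congrFun hx0 i)
  exact (LinearMap.finrank_le_finrank_of_injective hφ).trans_eq
    (Module.finrank_fintype_fun_eq_card ℝ)

/-- A kernel vector satisfies 2 · energy + (sum)² = 0, so its energy is nonpositive; if it also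
vanishes on `B` it must be zero. -/
theorem card_le_rank_add_card {B : Finset V} (hB : G.EnergyPosOn ((B : Set V)ᶜ)) :
    Fintype.card V ≤ (seidelMatrix G + (5 : ℝ) • 1).rank + B.card := by
  have h1 := rank_add_finrank_ker (seidelMatrix G + (5 : ℝ) • 1)
  have h2 := finrank_ker_le_of_injective (ι := B) (seidelMatrix G + (5 : ℝ) • 1) Subtype.val
    fun x hx hx0 => by
      by_contra hne
      have h3 := hB x (fun v hv => hx0 ⟨v, by simpa using hv⟩) hne
      have h4 := dotProduct_seidelMatrix_add_five_mulVec (G := G) x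
      rw [hx, dotProduct_zero] at h4
      nlinarith [sq_nonneg (∑ v, x v)]
  rw [Fintype.card_coe] at h2
  omega

/-- A zero of a nonnegative form is a minimum; otherwise a change at one vertex would make the
energy negative. -/
theorem mulVec_eq_zero_of_energy_eq_zero (hQ : ∀ x, 0 ≤ G.energy x) {x : V → ℝ}
    (hx : G.energy x = 0) : G.twoSubAdj.mulVec x = 0 := by
  funext w
  by_contra hw
  have h := hQ (x + Pi.single w (-(G.twoSubAdj.mulVec x w) / 2))
  rw [energy_add, energy_single, dotProduct_twoSubAdj_comm, single_dotProduct, hx] at h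
  have h2 : 0 < (G.twoSubAdj.mulVec x w) ^ 2 := by
    have : G.twoSubAdj.mulVec x w ≠ 0 := hw
    positivity
  nlinarith

theorem abs_mem_ker (hQ : ∀ x, 0 ≤ G.energy x) {x : V → ℝ}
    (hx : G.twoSubAdj.mulVec x = 0) : G.twoSubAdj.mulVec |x| = 0 := by
  refine mulVec_eq_zero_of_energy_eq_zero hQ (le_antisymm ?_ (hQ _))
  refine (G.energy_abs_le x).trans ?_
  simp [energy, hx]

/-- By the kernel equation for `|x|`, a zero at a vertex makes a sum of nonnegative neighbouring
values vanish, so the zero spreads along edges. -/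
theorem eq_zero_of_reachable (hQ : ∀ x, 0 ≤ G.energy x) {x : V → ℝ}
    (hx : G.twoSubAdj.mulVec x = 0) {v w : V} (hvw : G.Reachable v w) (hv : x v = 0) :
    x w = 0 := by
  obtain ⟨p⟩ := hvw
  induction p with
  | nil => exact hv
  | @cons a b _ hab _ ih =>
    refine ih ?_
    have h1 := congrFun (abs_mem_ker hQ hx) a
    rw [twoSubAdj_mulVec_apply] at h1
    simp only [Pi.abs_apply, hv, abs_zero, mul_zero, zero_sub, Pi.zero_apply, neg_eq_zero] at h1
    rw [Finset.sum_eq_zero_iff_of_nonneg fun u _ => abs_nonneg (x u)] at h1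
    exact abs_eq_zero.mp (h1 b (by simpa using hab))

/-- A connected component on which a vector of the kernel of `2 I - A` does not vanish has at least
three vertices. -/
theorem three_le_card_component [DecidableEq G.ConnectedComponent] (hQ : ∀ x, 0 ≤ G.energy x)
    {x : V → ℝ} (hx : G.twoSubAdj.mulVec x = 0) {v : V} (hv : x v ≠ 0) :
    3 ≤ (Finset.univ.filter fun u => G.connectedComponentMk u = G.connectedComponentMk v).card := by
  -- Where `|x|` is largest on the component, 2|x u| is a sum of deg(u) values not exceeding |x u|,
  -- so `u` has at least two neighbours.
  obtain ⟨u, hu, hmax⟩ := Finset.exists_max_image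
    (Finset.univ.filter fun u => G.connectedComponentMk u = G.connectedComponentMk v)
    (fun u => |x u|) ⟨v, by simp⟩
  have huv : G.connectedComponentMk u = G.connectedComponentMk v := (Finset.mem_filter.mp hu).2
  have hmem : ∀ w, G.Adj u w →
      w ∈ Finset.univ.filter fun u => G.connectedComponentMk u = G.connectedComponentMk v :=
    fun w hw => Finset.mem_filter.mpr ⟨Finset.mem_univ w,
      (ConnectedComponent.connectedComponentMk_eq_of_adj hw).symm.trans huv⟩
  have hpos : 0 < |x u| := (abs_pos.mpr hv).trans_le (hmax v (by simp))
  have h1 := congrFun (abs_mem_ker hQ hx) u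
  rw [twoSubAdj_mulVec_apply] at h1
  have h2 : ∑ w ∈ G.neighborFinset u, |x| w ≤ (G.neighborFinset u).card • |x u| :=
    Finset.sum_le_card_nsmul _ _ _ fun w hw => hmax w (hmem w (by simpa using hw))
  rw [nsmul_eq_mul] at h2
  simp only [Pi.abs_apply, Pi.zero_apply] at h1 h2
  have h3 : (2 : ℝ) ≤ (G.neighborFinset u).card := by nlinarith
  have h4 : 2 ≤ (G.neighborFinset u).card := by exact_mod_cast h3
  have h5 : (insert u (G.neighborFinset u)).card = (G.neighborFinset u).card + 1 :=
    Finset.card_insert_of_notMem (by simp)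
  refine (by omega : 3 ≤ (insert u (G.neighborFinset u)).card).trans
    (Finset.card_le_card (Finset.insert_subset hu fun w hw => hmem w (by simpa using hw)))

theorem three_mul_finrank_ker_le (hQ : ∀ x, 0 ≤ G.energy x) :
    3 * Module.finrank ℝ (LinearMap.ker G.twoSubAdj.mulVecLin) ≤ Fintype.card V := by
  classical
  set big : Finset G.ConnectedComponent := Finset.univ.filter fun C =>
    3 ≤ (Finset.univ.filter fun u => G.connectedComponentMk u = C).card with hbig
  -- One representative per large component determines a kernel vector: it vanishes on small
  -- components, and elsewhere a zero spreads.
  have h1 := finrank_ker_le_of_injective (ι := big) G.twoSubAdj (fun C => C.1.out)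
    fun x hx hx0 => by
      by_contra hne
      obtain ⟨v, hv⟩ := Function.ne_iff.mp hne
      refine hv (eq_zero_of_reachable hQ hx (ConnectedComponent.exact ?_)
        (hx0 ⟨G.connectedComponentMk v, by
          simpa [hbig] using three_le_card_component hQ hx hv⟩))
      exact Quot.out_eq (G.connectedComponentMk v)
  rw [Fintype.card_coe] at h1
  have h2 : Fintype.card V =
      ∑ C, (Finset.univ.filter fun u => G.connectedComponentMk u = C).card :=
    Finset.card_eq_sum_card_fiberwise fun v _ => Finset.mem_coe.mpr (Finset.mem_univ _)
  have h3 : big.card • 3 ≤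
      ∑ C ∈ big, (Finset.univ.filter fun u => G.connectedComponentMk u = C).card :=
    Finset.card_nsmul_le_sum _ _ _ fun C hC => (Finset.mem_filter.mp hC).2
  have h4 := Finset.sum_le_sum_of_subset (Finset.subset_univ big)
    (f := fun C => (Finset.univ.filter fun u => G.connectedComponentMk u = C).card)
  rw [smul_eq_mul] at h3
  omega

theorem rank_ge_of_energy_nonneg (hcard : 3 ≤ Fintype.card V)
    (hQ : ∀ x, 0 ≤ G.energy x) :
    2 * Fintype.card V + 3 ≤ 3 * (seidelMatrix G + (5 : ℝ) • 1).rank := by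
  have h1 := rank_add_finrank_ker (seidelMatrix G + (5 : ℝ) • 1)
  have h2 := three_mul_finrank_ker_le hQ
  have hker : ∀ x, (seidelMatrix G + (5 : ℝ) • 1).mulVec x = 0 →
      G.twoSubAdj.mulVec x = 0 ∧ ∑ v, x v = 0 := by
    intro x hx
    have h4 := dotProduct_seidelMatrix_add_five_mulVec (G := G) x
    rw [hx, dotProduct_zero] at h4
    have h5 := hQ x
    have h6 := sq_nonneg (∑ v, x v)
    exact ⟨mulVec_eq_zero_of_energy_eq_zero hQ (by linarith),
      pow_eq_zero_iff two_ne_zero |>.mp (by linarith)⟩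
  by_cases hbot : LinearMap.ker (seidelMatrix G + (5 : ℝ) • 1).mulVecLin = ⊥
  · rw [hbot, finrank_bot] at h1
    omega
  · obtain ⟨x, hx, hx0⟩ := Submodule.exists_mem_ne_zero_of_ne_bot hbot
    have hx1 := hker x hx
    -- Strictness supplies the "+1" in the bound: `|x|` lies in ker(2I - A) but has positive sum.
    have hlt : LinearMap.ker (seidelMatrix G + (5 : ℝ) • 1).mulVecLin <
        LinearMap.ker G.twoSubAdj.mulVecLin := by
      refine lt_of_le_of_ne (fun y hy => ?_) fun heq => ?_
      · simpa using (hker y hy).1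
      · have h3 : |x| ∈ LinearMap.ker (seidelMatrix G + (5 : ℝ) • 1).mulVecLin := by
          rw [heq]
          simpa using abs_mem_ker hQ hx1.1
        have h4 := (hker |x| h3).2
        have h5 := sum_pos_of_nonneg_of_ne_zero (abs_nonneg x)
          (fun h => hx0 (funext fun v => abs_eq_zero.mp (congrFun h v)))
        exact h5.ne' h4
    have h3 := Submodule.finrank_lt_finrank_of_lt hlt
    omega

end Rank
end SimpleGraph

/-! ### Switching invariance, the eigenvalue hypothesis and the conclusion. -/

theorem IsSeidel.eq_seidelMatrix {V : Type*} [DecidableEq V] {S : Matrix V V ℝ} (hS : IsSeidel S) :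
    seidelMatrix hS.graph = S := by
  classical
  ext i j
  by_cases hij : i = j
  · subst hij
    rw [(isSeidel_seidelMatrix _).diag, hS.diag]
  · rcases hS.offDiag i j hij with h | h
    · have : ¬ hS.graph.Adj i j := fun hadj => by
        have := hadj.2
        rw [h] at this
        norm_num at this
      simp [seidelMatrix, hij, this, h]
    · have : hS.graph.Adj i j := ⟨hij, h⟩
      norm_num [seidelMatrix, hij, this, h]

theorem switchDiag_mul_self {V : Type*} [Fintype V] [DecidableEq V] (U : Finset V) :
    switchDiag U * switchDiag U = 1 := by
  rw [switchDiag, Matrix.diagonal_mul_diagonal, ← Matrix.diagonal_one]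
  congr 1
  funext i
  split_ifs <;> norm_num

theorem switchMatrix_add_smul_one {V : Type*} [Fintype V] [DecidableEq V] (S : Matrix V V ℝ)
    (U : Finset V) (c : ℝ) :
    switchMatrix S U + c • 1 = switchDiag U * (S + c • 1) * switchDiag U := by
  rw [mul_add, add_mul, switchMatrix, Matrix.mul_smul, mul_one, Matrix.smul_mul,
    switchDiag_mul_self]

theorem dotProduct_switchMatrix_add_smul_one {V : Type*} [Fintype V] [DecidableEq V]
    (S : Matrix V V ℝ) (U : Finset V) (c : ℝ) (x : V → ℝ) :
    x ⬝ᵥ (switchMatrix S U + c • 1).mulVec x =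
      (switchDiag U).mulVec x ⬝ᵥ (S + c • 1).mulVec ((switchDiag U).mulVec x) := by
  rw [switchMatrix_add_smul_one, ← Matrix.mulVec_mulVec, ← Matrix.mulVec_mulVec,
    Matrix.dotProduct_mulVec, ← Matrix.mulVec_transpose, switchDiag, Matrix.diagonal_transpose]

theorem rank_switchMatrix_add_smul_one {V : Type*} [Fintype V] [DecidableEq V]
    (S : Matrix V V ℝ) (U : Finset V) (c : ℝ) :
    (switchMatrix S U + c • 1).rank = (S + c • 1).rank := by
  have hU : IsUnit (switchDiag U).det :=
    (Matrix.isUnit_iff_isUnit_det _).mp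
      ⟨⟨switchDiag U, switchDiag U, switchDiag_mul_self U, switchDiag_mul_self U⟩, rfl⟩
  rw [switchMatrix_add_smul_one, Matrix.rank_mul_eq_left_of_isUnit_det _ _ hU,
    Matrix.rank_mul_eq_right_of_isUnit_det _ _ hU]

/-- Each eigenvalue of S - μI is an eigenvalue of `S` lowered by μ, hence nonnegative by minimality;
the spectral theorem does the rest. -/
theorem IsSmallestEigenvalue.dotProduct_nonneg {V : Type*} [Fintype V] [DecidableEq V]
    {S : Matrix V V ℝ} {μ : ℝ} (hS : S.IsSymm) (h : IsSmallestEigenvalue S μ) (x : V → ℝ) :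
    0 ≤ x ⬝ᵥ (S + (-μ) • 1).mulVec x := by
  have hB : (S + (-μ) • (1 : Matrix V V ℝ)).IsHermitian :=
    hS.add (Matrix.isSymm_one.smul (-μ))
  have hpsd : (S + (-μ) • (1 : Matrix V V ℝ)).PosSemidef := by
    rw [hB.posSemidef_iff_eigenvalues_nonneg]
    intro i
    have h1 := hB.mulVec_eigenvectorBasis i
    set b : V → ℝ := ⇑(hB.eigenvectorBasis i) with hb
    have hb0 : b ≠ 0 := fun h0 =>
      hB.eigenvectorBasis.orthonormal.ne_zero i (PiLp.ext fun j => congrFun h0 j)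
    rw [Matrix.add_mulVec, Matrix.smul_mulVec, Matrix.one_mulVec] at h1
    have h2 : Module.End.HasEigenvalue (Matrix.toLin' S) (hB.eigenvalues i + μ) := by
      refine Module.End.hasEigenvalue_of_hasEigenvector (x := b)
        ⟨Module.End.mem_eigenspace_iff.mpr ?_, hb0⟩
      rw [Matrix.toLin'_apply, add_smul, ← h1]
      module
    have h3 := h.2 h2
    simp only [Pi.zero_apply]
    linarith
  simpa using hpsd.dotProduct_mulVec_nonneg x

theorem mainTheorem10 (n : ℕ) (hn : 277 ≤ n) (S : Matrix (Fin n) (Fin n) ℝ) (hS : IsSeidel S)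
    (hmin : IsSmallestEigenvalue S (-5))
    (G : SimpleGraph (Fin n)) [DecidableRel G.Adj] (hG : G ∈ hS.switchingClass)
    (hdeg : G.maxDegree ≤ 16) :
    ((S + (5 : ℝ) • (1 : Matrix (Fin n) (Fin n) ℝ)).rank : ℝ) ≥ 2 * (n : ℝ) / 3 + 1 := by
  obtain ⟨U, hGU⟩ := hG
  have hmat : seidelMatrix G = switchMatrix S U := by
    rw [hGU, switchGraph, IsSeidel.eq_seidelMatrix, hS.eq_seidelMatrix]
  have hM : G.TwoSubAdjAddOnesNonneg := fun x => by
    rw [← SimpleGraph.dotProduct_seidelMatrix_add_five_mulVec, hmat,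
      dotProduct_switchMatrix_add_smul_one]
    simpa using hmin.dotProduct_nonneg hS.symm ((switchDiag U).mulVec x)
  have hrank : 2 * n + 3 ≤ 3 * (seidelMatrix G + (5 : ℝ) • 1).rank := by
    by_cases hQ : ∀ x, 0 ≤ G.energy x
    · simpa using SimpleGraph.rank_ge_of_energy_nonneg (by simpa using by omega) hQ
    · push Not at hQ
      obtain ⟨B, hB, hpos⟩ := SimpleGraph.exists_energyPosOn_of_exists_energy_neg hM
        (fun v => (G.degree_le_maxDegree v).trans hdeg) hQ
      have := SimpleGraph.card_le_rank_add_card hpos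
      rw [Fintype.card_fin] at this
      -- From n ≤ rank + 91 one gets 3 · rank ≥ 3n - 273, which is at least 2n + 3 once n ≥ 276.
      omega
  rw [hmat, rank_switchMatrix_add_smul_one] at hrank
  have : ((2 * n + 3 : ℕ) : ℝ) ≤ ((3 * (S + (5 : ℝ) • 1).rank : ℕ) : ℝ) := by exact_mod_cast hrank
  push_cast at this
  linarith
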